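/- Let $\Lambda$ be the ring of symmetric functions in $X=x_1+x_2+\cdots$ with coefficients in $\mathbb{Q}[q]$, with elementary symmetric functions $e_r$ ($e_0=1$) and power sums $p_k$, and write $e_\mu=e_{\mu_1}e_{\mu_2}\cdots$ for a partition $\mu$. For $a\ge 1$ let $B_a:\Lambda\to\Lambda$ be the modified Hall–Littlewood operator $$B_aF[X]=F\Big[X+\epsilon\frac{1-q}{z}\Big]\sum_{r\ge 0}z^re_r[X]\,\Big|_{z^a},$$ where $|_{z^a}$ denotes the coefficient of $z^a$, and $F\mapsto F[X+\epsilon\frac{1-q}{z}]$ is the $\mathbb{Q}[q]$-algebra homomorphism on $\Lambda$ with $p_k\mapsto p_k+(-1)^k(1-q^k)z^{-k}$ for all $k\ge 1$. For a composition $p=(p_1,\dots,p_k)$ of $n$ put $B_p\,1=B_{p_1}B_{p_2}\cdots B_{p_k}\,1$. **Theorem 2.1.** For every $n\ge 0$ and every composition $p$ of $n$ there are polynomials $P_\mu(q)\in\mathbb{N}[q]$, one for each partition $\mu$ of $n$, such that $$B_p\,1\Big|_{q=1+q}=\sum_{\mu\vdash n}e_\mu\,P_\mu(q),$$ where the left-hand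 side is obtained from $B_p\,1$ by substituting $1+q$ for $q$ in all coefficients. -/

import Mathlib

noncomputable section

namespace SymmFn

open MvPolynomial

/-- Setting the last variable equal to zero: `R[x₁,…,xₙ₊₁] → R[x₁,…,xₙ]`. -/
def restrict (R : Type*) [CommRing R] (n : ℕ) :
    MvPolynomial (Fin (n + 1)) R →ₐ[R] MvPolynomial (Fin n) R :=
  aeval (Fin.snoc (α := fun _ => MvPolynomial (Fin n) R) (fun i => X i) 0)

/-- The ring `Λ_R` of symmetric functions with coefficients in `R`, in the variables
`x₁, x₂, x₃, …`: a symmetric function is a family of symmetric polynomials `f n ∈ R[x₁,…,xₙ]` of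
bounded degree, compatible with setting the last variable equal to zero (that is, `Λ_R` is the
inverse limit of the rings of symmetric polynomials in the category of graded rings). -/
def SymFun (R : Type*) [CommRing R] : Subalgebra R (∀ n : ℕ, MvPolynomial (Fin n) R) where
  carrier := {f | (∀ n, (f n).IsSymmetric) ∧ (∀ n, restrict R n (f (n + 1)) = f n) ∧
    ∃ d : ℕ, ∀ n, (f n).totalDegree ≤ d}
  mul_mem' := by
    rintro f g ⟨hf, hf', d, hd⟩ ⟨hg, hg', e, he⟩
    refine ⟨fun n => (hf n).mul (hg n), fun n => ?_, d + e, fun n => ?_⟩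
    · simp only [Pi.mul_apply, map_mul, hf', hg']
    · exact (totalDegree_mul _ _).trans (add_le_add (hd n) (he n))
  add_mem' := by
    rintro f g ⟨hf, hf', d, hd⟩ ⟨hg, hg', e, he⟩
    refine ⟨fun n => (hf n).add (hg n), fun n => ?_, max d e, fun n => ?_⟩
    · simp only [Pi.add_apply, map_add, hf', hg']
    · exact (totalDegree_add _ _).trans (max_le_max (hd n) (he n))
  algebraMap_mem' := by
    intro r
    refine ⟨fun n => IsSymmetric.C r, fun n => ?_, 0, fun n => ?_⟩
    · exact (restrict R n).commutes r
    · exact (totalDegree_C r).le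

section basic

variable (R : Type*) [CommRing R]

theorem restrict_esymm (n k : ℕ) :
    restrict R n (esymm (Fin (n + 1)) R k) = esymm (Fin n) R k := by
  rw [restrict, aeval_esymm_eq_multiset_esymm, esymm_eq_multiset_esymm]
  have h : (Finset.univ : Finset (Fin (n + 1))).val.map
      (Fin.snoc (α := fun _ => MvPolynomial (Fin n) R) (fun i => X i) 0) =
      (0 : MvPolynomial (Fin n) R) ::ₘ (Finset.univ : Finset (Fin n)).val.map X := by
    rw [Fin.univ_castSuccEmb]
    simp
  rw [h]
  cases k with
  | zero => simp [Multiset.esymm]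
  | succ k =>
    rw [Multiset.esymm, Multiset.esymm, Multiset.powersetCard_cons, Multiset.map_add,
      Multiset.map_map, Multiset.sum_add]
    simp

theorem restrict_psum (n k : ℕ) (hk : k ≠ 0) :
    restrict R n (psum (Fin (n + 1)) R k) = psum (Fin n) R k := by
  simp [restrict, psum, Fin.sum_univ_castSucc, hk]

theorem isHomogeneous_psum (n k : ℕ) : (psum (Fin n) R k).IsHomogeneous k :=
  IsHomogeneous.sum _ _ _ fun i _ => isHomogeneous_X_pow i k

theorem isHomogeneous_esymm (n k : ℕ) : (esymm (Fin n) R k).IsHomogeneous k := by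
  refine IsHomogeneous.sum _ _ _ fun s hs => ?_
  have h := IsHomogeneous.prod s (fun i => (X i : MvPolynomial (Fin n) R)) (fun _ => 1)
    fun i _ => isHomogeneous_X R i
  simpa [(Finset.mem_powersetCard.mp hs).2] using h

/-- The elementary symmetric function `e_k`, with `e_0 = 1`. -/
def e (k : ℕ) : SymFun R :=
  ⟨fun n => esymm (Fin n) R k, fun _ => esymm_isSymmetric _ _ k, fun n => restrict_esymm R n k,
    k, fun _ => (isHomogeneous_esymm R _ k).totalDegree_le⟩

/-- The power sum symmetric functions, `p i = x₁ ^ (i + 1) + x₂ ^ (i + 1) + ⋯`.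
Note the shift of the index: `p i` has degree `i + 1`. -/
def p (i : ℕ) : SymFun R :=
  ⟨fun n => psum (Fin n) R (i + 1), fun _ => psum_isSymmetric _ _ _,
    fun n => restrict_psum R n _ i.succ_ne_zero,
    i + 1, fun _ => (isHomogeneous_psum R _ _).totalDegree_le⟩

/-- Substitution of the power sums for the variables: `R[t₀, t₁, …] → Λ_R`, `t_i ↦ p i`. -/
def pHom : MvPolynomial ℕ R →ₐ[R] SymFun R := aeval (p R)

theorem pHom_apply (Q : MvPolynomial ℕ R) (n : ℕ) :
    (pHom R Q).1 n = aeval (fun i : ℕ => psum (Fin n) R (i + 1)) Q := by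
  have h : ((Pi.evalAlgHom R (fun n : ℕ => MvPolynomial (Fin n) R) n).comp
      (SymFun R).val).comp (pHom R) = aeval (fun i : ℕ => psum (Fin n) R (i + 1)) := by
    ext i : 1
    simp [pHom, p]
  exact DFunLike.congr_fun h Q

theorem homogeneousComponent_aeval_psum (n k : ℕ) (Q : MvPolynomial ℕ R) :
    homogeneousComponent k (aeval (fun i : ℕ => psum (Fin n) R (i + 1)) Q) =
      aeval (fun i : ℕ => psum (Fin n) R (i + 1))
        (weightedHomogeneousComponent (fun i : ℕ => i + 1) k Q) := by
  induction Q using MvPolynomial.induction_on' with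
  | add P Q hP hQ => simp only [map_add, hP, hQ]
  | monomial m r =>
    have hw := isWeightedHomogeneous_monomial (fun i : ℕ => i + 1) m r rfl
    have hh : (aeval (fun i : ℕ => psum (Fin n) R (i + 1)) (monomial m r)).IsHomogeneous
        (Finsupp.weight (fun i : ℕ => i + 1) m) := by
      rw [aeval_monomial, algebraMap_eq, Finsupp.prod, Finsupp.weight_apply, Finsupp.sum]
      refine IsHomogeneous.C_mul (IsHomogeneous.prod _ _ _ fun i _ => ?_) r
      rw [smul_eq_mul, mul_comm]
      exact (isHomogeneous_psum R n _).pow _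
    rw [weightedHomogeneousComponent_of_mem hw, homogeneousComponent_of_mem hh]
    split_ifs <;> simp

/-- A symmetric function of degree at most `d` is determined by its restriction to `d`
variables. -/
theorem eq_zero_of_apply_eq_zero (f : SymFun R) (d : ℕ) (hd : ∀ n, (f.1 n).totalDegree ≤ d)
    (h0 : f.1 d = 0) : f = 0 := by
  obtain ⟨f, hs, hr, hb⟩ := f
  change ∀ n, (f n).totalDegree ≤ d at hd
  change f d = 0 at h0
  have hup : ∀ m, f (d + m) = 0 := by
    intro m
    induction m with
    | zero => exact h0
    | succ m ih =>
      have hres : restrict R (d + m) (f (d + m + 1)) = 0 := (hr (d + m)).trans ih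
      have hcast : ∀ t : Fin (d + m) →₀ ℕ, coeff t (restrict R (d + m) (f (d + m + 1))) =
          coeff (t.mapDomain Fin.castSucc) (f (d + m + 1)) := by
        intro t
        induction f (d + m + 1) using MvPolynomial.induction_on' with
        | add P Q hP hQ => simp only [map_add, coeff_add, hP, hQ]
        | monomial s r =>
          by_cases hs : s (Fin.last _) = 0
          · have hs' : s = (s.comapDomain Fin.castSucc
                (Fin.castSucc_injective _).injOn).mapDomain Fin.castSucc := by
              ext i
              refine Fin.lastCases ?_ (fun j => ?_) i
              · rw [hs, Finsupp.mapDomain_of_notMem_range]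
                rintro ⟨j, hj⟩
                exact (Fin.castSucc_lt_last j).ne hj
              · rw [Finsupp.mapDomain_apply (Fin.castSucc_injective _)]
                simp
            rw [hs']
            generalize s.comapDomain Fin.castSucc _ = u
            rw [restrict, aeval_monomial, Finsupp.prod_mapDomain_index_inj
              (Fin.castSucc_injective _)]
            simp only [Fin.snoc_castSucc]
            rw [algebraMap_eq, ← monomial_eq, coeff_monomial, coeff_monomial]
            simp only [(Finsupp.mapDomain_injective (Fin.castSucc_injective _)).eq_iff]
          · have hz : restrict R (d + m) (monomial s r) = 0 := by
              rw [restrict, aeval_monomial, Finsupp.prod,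
                Finset.prod_eq_zero (i := Fin.last _) (by simpa using hs) (by simp [hs]),
                mul_zero]
            rw [hz, coeff_zero, coeff_monomial, if_neg]
            rintro rfl
            apply hs
            rw [Finsupp.mapDomain_of_notMem_range]
            rintro ⟨j, hj⟩
            exact (Fin.castSucc_lt_last j).ne hj
      have hlast : ∀ s : Fin (d + m + 1) →₀ ℕ, s (Fin.last _) = 0 →
          coeff s (f (d + m + 1)) = 0 := by
        intro s hs
        have hs' : s = (s.comapDomain Fin.castSucc
            (Fin.castSucc_injective _).injOn).mapDomain Fin.castSucc := by
          ext i
          refine Fin.lastCases ?_ (fun j => ?_) i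
          · rw [hs, Finsupp.mapDomain_of_notMem_range]
            rintro ⟨j, hj⟩
            exact (Fin.castSucc_lt_last j).ne hj
          · rw [Finsupp.mapDomain_apply (Fin.castSucc_injective _)]
            simp
        rw [hs', ← hcast, hres, coeff_zero]
      change f (d + m + 1) = 0
      ext s
      rw [coeff_zero]
      by_contra hne
      have hdeg : s.degree ≤ d := by
        rw [Finsupp.degree_eq_sum]
        have h1 := (le_totalDegree (mem_support_iff.mpr hne)).trans (hd (d + m + 1))
        rwa [Finsupp.sum_fintype _ _ (fun _ => rfl)] at h1
      obtain ⟨i, hi⟩ : ∃ i, s i = 0 := by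
        by_contra! hall
        have h2 : ∑ _i : Fin (d + m + 1), 1 ≤ ∑ i, s i :=
          Finset.sum_le_sum fun i _ => Nat.one_le_iff_ne_zero.mpr (hall i)
        rw [Finsupp.degree_eq_sum] at hdeg
        simp at h2
        omega
      have hsw := hs (d + m + 1) (Equiv.swap i (Fin.last _))
      apply hne
      rw [← hsw, ← Finsupp.mapDomain_id (v := s)]
      have : s.mapDomain id = (s.mapDomain (Equiv.swap i (Fin.last (d + m)))).mapDomain
          (Equiv.swap i (Fin.last (d + m))) := by
        rw [← Finsupp.mapDomain_comp]
        congr 1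
        ext x
        simp
      rw [this, coeff_rename_mapDomain _ (Equiv.injective _)]
      apply hlast
      have h3 := Finsupp.mapDomain_apply (Equiv.swap i (Fin.last (d + m))).injective s i
      rw [Equiv.swap_apply_left] at h3
      rw [h3, hi]
  have hdown : ∀ m n, n + m = d → f n = 0 := by
    intro m
    induction m with
    | zero => rintro n rfl; exact h0
    | succ m ih =>
      intro n hn
      rw [← hr n, ih (n + 1) (by omega), map_zero]
  ext n : 2
  rcases le_total d n with h | h
  · obtain ⟨m, rfl⟩ := Nat.exists_eq_add_of_le h
    exact hup m
  · obtain ⟨m, hm⟩ := Nat.exists_eq_add_of_le h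
    exact hdown m n hm.symm

end basic

section powersums

variable (R : Type*) [CommRing R] [Algebra ℚ R]

theorem esymm_mem_range (n k : ℕ) (hk : k ≤ n) : esymm (Fin n) R k ∈
    (aeval (fun i : Fin n => psum (Fin n) R (i + 1)) :
      MvPolynomial (Fin n) R →ₐ[R] MvPolynomial (Fin n) R).range := by
  induction k using Nat.strong_induction_on with
  | _ k ih =>
    rcases Nat.eq_zero_or_pos k with rfl | hpos
    · rw [esymm_zero]; exact one_mem _
    have hN := mul_esymm_eq_sum (Fin n) R k
    have hinv : esymm (Fin n) R k = algebraMap R (MvPolynomial (Fin n) R)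
        (algebraMap ℚ R (k : ℚ)⁻¹) * (k * esymm (Fin n) R k) := by
      have h1 : algebraMap R (MvPolynomial (Fin n) R) (algebraMap ℚ R (k : ℚ)⁻¹) * k = 1 := by
        have h2 : (k : MvPolynomial (Fin n) R) =
            algebraMap R (MvPolynomial (Fin n) R) (algebraMap ℚ R (k : ℚ)) := by simp
        rw [h2, ← map_mul, ← map_mul, inv_mul_cancel₀ (by exact_mod_cast hpos.ne'), map_one,
          map_one]
      rw [← mul_assoc, h1, one_mul]
    rw [hinv, hN]
    refine mul_mem (Subalgebra.algebraMap_mem _ _) (mul_mem (pow_mem (neg_mem (one_mem _)) _)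
      (sum_mem fun a ha => ?_))
    obtain ⟨ha, hlt⟩ := Finset.mem_filter.mp ha
    rw [Finset.HasAntidiagonal.mem_antidiagonal] at ha
    refine mul_mem (mul_mem (pow_mem (neg_mem (one_mem _)) _) (ih a.1 hlt (by omega))) ?_
    refine ⟨X ⟨a.2 - 1, by omega⟩, ?_⟩
    simp only [AlgHom.toRingHom_eq_coe, RingHom.coe_coe, aeval_X]
    congr 1
    omega

theorem isSymmetric_mem_range (n : ℕ) (f : MvPolynomial (Fin n) R) (hf : f.IsSymmetric) : f ∈
    (aeval (fun i : Fin n => psum (Fin n) R (i + 1)) :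
      MvPolynomial (Fin n) R →ₐ[R] MvPolynomial (Fin n) R).range := by
  obtain ⟨Q, hQ⟩ := (esymmAlgHom_fin_bijective R n).2 ⟨f, hf⟩
  have hf' : f = aeval (fun i : Fin n => esymm (Fin n) R (i + 1)) Q := by
    rw [← esymmAlgHom_apply, hQ]
  rw [hf']
  have h : (aeval (fun i : Fin n => esymm (Fin n) R (i + 1)) :
      MvPolynomial (Fin n) R →ₐ[R] MvPolynomial (Fin n) R).range ≤
      (aeval (fun i : Fin n => psum (Fin n) R (i + 1)) :
        MvPolynomial (Fin n) R →ₐ[R] MvPolynomial (Fin n) R).range := by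
    rw [← Algebra.adjoin_range_eq_range_aeval]
    refine Algebra.adjoin_le ?_
    rintro _ ⟨i, rfl⟩
    exact esymm_mem_range R n (i + 1) i.2
  exact h ⟨Q, rfl⟩

theorem pHom_surjective : Function.Surjective (pHom R) := by
  intro f
  obtain ⟨d, hd⟩ := f.2.2.2
  obtain ⟨Q, hQ⟩ := isSymmetric_mem_range R d (f.1 d) (f.2.1 d)
  set Q₁ : MvPolynomial ℕ R := rename Fin.val Q
  have hQ₁ : aeval (fun i : ℕ => psum (Fin d) R (i + 1)) Q₁ = f.1 d := by
    rw [← hQ, aeval_rename]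
    rfl
  set Q₂ : MvPolynomial ℕ R :=
    ∑ k ∈ Finset.range (d + 1), weightedHomogeneousComponent (fun i : ℕ => i + 1) k Q₁
  have hc : ∀ n, (pHom R Q₂).1 n = ∑ k ∈ Finset.range (d + 1),
      homogeneousComponent k (aeval (fun i : ℕ => psum (Fin n) R (i + 1)) Q₁) := by
    intro n
    rw [pHom_apply, map_sum]
    exact Finset.sum_congr rfl fun k _ => (homogeneousComponent_aeval_psum R n k Q₁).symm
  refine ⟨Q₂, sub_eq_zero.mp (eq_zero_of_apply_eq_zero R _ d (fun n => ?_) ?_)⟩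
  · refine (totalDegree_sub _ _).trans (max_le ?_ (hd n))
    rw [hc]
    refine totalDegree_finsetSum_le fun k hk => ?_
    exact (homogeneousComponent_isHomogeneous k _).totalDegree_le.trans
      (Nat.lt_succ_iff.mp (Finset.mem_range.mp hk))
  · change (pHom R Q₂).1 d - f.1 d = 0
    rw [hc, hQ₁, sub_eq_zero]
    conv_rhs => rw [← sum_homogeneousComponent (f.1 d)]
    symm
    refine Finset.sum_subset (Finset.range_mono (Nat.succ_le_succ (hd d))) fun k _ hk => ?_
    rw [Finset.mem_range, not_lt] at hk
    exact homogeneousComponent_eq_zero _ _ hk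

theorem injective_of_surjective {S : Type*} [CommRing S] [IsNoetherianRing S] (f : S →+* S)
    (hf : Function.Surjective f) : Function.Injective f := by
  have hmono : Monotone fun n : ℕ => RingHom.ker (f ^ n) := by
    refine monotone_nat_of_le_succ fun n x hx => ?_
    rw [RingHom.mem_ker] at hx ⊢
    rw [pow_succ', RingHom.mul_def, RingHom.comp_apply, hx, map_zero]
  obtain ⟨n, hn⟩ := monotone_stabilizes_iff_noetherian.mpr ‹IsNoetherianRing S› ⟨_, hmono⟩
  have hsurj : Function.Surjective (f ^ n) := by
    rw [RingHom.coe_pow]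
    exact hf.iterate n
  rw [injective_iff_map_eq_zero]
  intro x hx
  obtain ⟨y, rfl⟩ := hsurj x
  have hy : y ∈ RingHom.ker (f ^ (n + 1)) := by
    rw [RingHom.mem_ker, pow_succ', RingHom.mul_def, RingHom.comp_apply, hx]
  have hy' : y ∈ RingHom.ker (f ^ n) := by
    have h := hn (n + 1) n.le_succ
    simp only [OrderHom.coe_mk] at h
    rw [h]
    exact hy
  exact hy'

variable [IsNoetherianRing R]

theorem aeval_psum_injective (n : ℕ) : Function.Injective
    (aeval (fun i : Fin n => psum (Fin n) R (i + 1)) :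
      MvPolynomial (Fin n) R →ₐ[R] MvPolynomial (Fin n) R) := by
  set φ : MvPolynomial (Fin n) R →ₐ[R] symmetricSubalgebra (Fin n) R :=
    aeval (fun i => ⟨psum (Fin n) R (i + 1), psum_isSymmetric _ _ _⟩)
  have hφ : ∀ Q, (φ Q).1 = aeval (fun i : Fin n => psum (Fin n) R (i + 1)) Q := fun Q =>
    (Subalgebra.mvPolynomial_aeval_coe _ _ _).symm
  have hsurj : Function.Surjective φ := by
    rintro ⟨f, hf⟩
    obtain ⟨Q, hQ⟩ := isSymmetric_mem_range R n f hf
    exact ⟨Q, Subtype.ext ((hφ Q).trans hQ)⟩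
  set ε := esymmAlgEquiv (Fin n) R (Fintype.card_fin n)
  set ψ : MvPolynomial (Fin n) R →ₐ[R] MvPolynomial (Fin n) R :=
    ε.symm.toAlgHom.comp φ
  have hψ : Function.Surjective ψ := ε.symm.surjective.comp hsurj
  have hψ' : Function.Injective ψ :=
    injective_of_surjective ψ.toRingHom hψ
  intro P Q h
  rw [← hφ, ← hφ] at h
  exact hψ' (congrArg ε.symm (Subtype.ext h))

theorem pHom_injective : Function.Injective (pHom R) := by
  rw [injective_iff_map_eq_zero]
  intro Q hQ
  obtain ⟨s, Q, rfl⟩ := exists_finset_rename Q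
  set n := s.sup id + 1
  have hn : ∀ i ∈ s, i < n := fun i hi => Nat.lt_succ_of_le (Finset.le_sup (f := id) hi)
  set g : {x // x ∈ s} → Fin n := fun x => ⟨x.1, hn x.1 x.2⟩
  have hg : rename (Subtype.val : {x // x ∈ s} → ℕ) Q = rename Fin.val (rename g Q) := by
    rw [rename_rename]; rfl
  have h := pHom_apply R (rename (Subtype.val : {x // x ∈ s} → ℕ) Q) n
  rw [hQ, hg, aeval_rename] at h
  have h0 : rename g Q = 0 := by
    apply aeval_psum_injective R n
    rw [map_zero]
    exact h.symm
  rw [hg, h0, map_zero]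

/-- Every symmetric function is a polynomial in the power sums in exactly one way (the
coefficient ring being a `ℚ`-algebra): `R[t₀, t₁, …] ≃ Λ_R`, `t_i ↦ p i`. -/
def pEquiv : MvPolynomial ℕ R ≃ₐ[R] SymFun R :=
  AlgEquiv.ofBijective (pHom R) ⟨pHom_injective R, pHom_surjective R⟩

/-- Plethystic substitution `F ↦ F[E]` into a commutative ring `S` over `R`: the symmetric function
`F` is written as a polynomial in the power sums, and `p_k` is replaced by `p_k[E]`. The
expression `E` is given by the values `pE i = p_{i+1}[E]` and by the map `c` on the coefficients
of `F`. -/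
def plethysm {S : Type*} [CommRing S] (c : R →+* S) (pE : ℕ → S) : SymFun R →+* S :=
  (eval₂Hom c pE).comp (pEquiv R).symm.toRingEquiv.toRingHom

end powersums

/-- The coefficientwise application of a ring homomorphism, `Λ_R → Λ_S`. -/
def mapCoeff {R S : Type*} [CommRing R] [CommRing S] (φ : R →+* S) (f : SymFun R) : SymFun S :=
  ⟨fun n => MvPolynomial.map φ (f.1 n), fun n => (f.2.1 n).map φ, fun n => by
    change restrict S n (MvPolynomial.map φ (f.1 (n + 1))) = MvPolynomial.map φ (f.1 n)
    rw [← f.2.2.1 n]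
    generalize f.1 (n + 1) = g
    induction g using MvPolynomial.induction_on with
    | C r => simp [restrict]
    | add P Q hP hQ => simp only [map_add, hP, hQ]
    | mul_X P i hP =>
      simp only [map_mul, hP]
      congr 1
      refine Fin.lastCases ?_ (fun j => ?_) i <;> simp [restrict],
    f.2.2.2.imp fun d hd n =>
      (Finset.sup_mono (support_map_subset φ (f.1 n))).trans (hd n)⟩

/-- The coefficient ring `ℚ[q]`. -/
abbrev Qq : Type := Polynomial ℚ

/-- The indeterminate `q`. -/
abbrev q : Qq := Polynomial.X

/-- The substitution `q ↦ 1 + q` in the coefficients of a symmetric function, written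
`F |_{q = 1+q}`. -/
def shift (F : SymFun Qq) : SymFun Qq :=
  mapCoeff (Polynomial.compRingHom (1 + q)) F

/-- `F[X + ε(1-q)/z]`, a Laurent series (in fact a polynomial in `1/z`) with coefficients in
`Λ_{ℚ[q]}`. Here `p_k[X + ε(1-q)/z] = p_k + (-1)^k (1 - q^k) z^{-k}`, since `ε` is the plethystic
sign with `p_k[ε E] = (-1)^k p_k[E]`, and `q`, `z` are variables. -/
def translate : SymFun Qq →+* LaurentSeries (SymFun Qq) :=
  plethysm Qq (HahnSeries.C.comp (algebraMap Qq (SymFun Qq))) fun i =>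
    HahnSeries.C (p Qq i) +
      HahnSeries.single (-((i : ℤ) + 1))
        (algebraMap Qq (SymFun Qq) ((-1) ^ (i + 1) * (1 - q ^ (i + 1))))

/-- The generating series `∑_{r ≥ 0} z^r e_r`. -/
def eSeries : LaurentSeries (SymFun Qq) :=
  HahnSeries.ofPowerSeries ℤ (SymFun Qq) (PowerSeries.mk (e Qq))

/-- The modified Hall–Littlewood operator
`B_a F[X] = F[X + ε(1-q)/z] ∑_{r ≥ 0} z^r e_r[X] |_{z^a}`. -/
def B (a : ℤ) (F : SymFun Qq) : SymFun Qq :=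
  (translate F * eSeries).coeff a

/-- `B_{p_1} B_{p_2} ⋯ B_{p_k} 1` for a list `p = (p_1, …, p_k)`. -/
def Bone (l : List ℕ) : SymFun Qq :=
  l.foldr (fun a F => B a F) 1

/-- `e_μ = e_{μ_1} e_{μ_2} ⋯` for a partition `μ`. -/
def ePart {n : ℕ} (μ : n.Partition) : SymFun Qq :=
  (μ.parts.map (e Qq)).prod

end SymmFn

end

namespace SymmFn

open MvPolynomial

/-! The translation `F ↦ F[X + ε(1-q)/z]` is a ring homomorphism, so it is governed by its values on
the `e_r`. Since `∑ e_r u^r = exp(∑ (-1)^(k-1) p_k u^k / k)`, it multiplies this series by `exp(-∑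
(1 - q^k) (u/z)^k / k) = (1 - u/z) / (1 - q u/z)`. This is `translate_e`; it is derived from
Newton's identities by comparing logarithmic derivatives, so no exponential is needed.

The coefficients of `(1 - t) / (1 - q t)` are `1` and `(q - 1) q^j`; under `q ↦ 1 + q` the latter
become `q (1 + q)^j`, which lie in `ℕ[q]`. Hence the cone `ePos`, spanned by products of the `e_r`
with coefficients in `ℕ[q - 1]`, is preserved by every ingredient of `B_a`: translation,
multiplication by `∑ z^r e_r`, and extraction of a coefficient. Starting from `1`, every `B_p 1`
lies in the cone. The degree is tracked alongside, so that only partitions of `n` occur. -/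

/-! ### Newton's identities and logarithmic derivatives -/

/-- A power series over a `ℚ`-algebra is determined by its logarithmic derivative and its constant
coefficient. -/
theorem powerSeries_eq_of_derivative_eq_mul {A : Type*} [CommRing A] [Algebra ℚ A]
    {f g P : PowerSeries A} (h0 : PowerSeries.coeff 0 f = PowerSeries.coeff 0 g)
    (hf : PowerSeries.derivative A f = f * P) (hg : PowerSeries.derivative A g = g * P) :
    f = g := by
  ext n
  induction n using Nat.strong_induction_on with
  | _ n ih =>
    cases n with
    | zero => exact h0
    | succ n =>
      have hu : IsUnit ((n : A) + 1) := by
        have h := (IsUnit.mk0 ((n : ℚ) + 1) (by positivity)).map (algebraMap ℚ A)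
        simpa using h
      apply hu.mul_right_cancel
      rw [← PowerSeries.coeff_derivative, ← PowerSeries.coeff_derivative, hf, hg,
        PowerSeries.coeff_mul, PowerSeries.coeff_mul]
      refine Finset.sum_congr rfl fun x hx => ?_
      rw [ih x.1 (by have := Finset.HasAntidiagonal.mem_antidiagonal.mp hx; omega)]

/-- Newton's identities in `Λ_R`. -/
theorem e_succ_mul_eq_sum (R : Type*) [CommRing R] (k : ℕ) :
    e R (k + 1) * (k + 1) =
      ∑ x ∈ Finset.HasAntidiagonal.antidiagonal k, e R x.1 * ((-1) ^ x.2 * p R x.2) := by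
  ext n : 2
  have hN := mul_esymm_eq_sum (Fin n) R (k + 1)
  -- The term split off is the pair `(k + 1, 0)`, which the filter excludes; the rest is reindexed
  -- to match the shifted `p`.
  rw [Finset.sum_filter, Finset.Nat.sum_antidiagonal_succ', if_neg (by simp), zero_add,
    Finset.mul_sum] at hN
  have hl : (e R (k + 1) * (k + 1)).1 n = ((k + 1 : ℕ) : MvPolynomial (Fin n) R) *
      esymm (Fin n) R (k + 1) := by
    rw [mul_comm]
    simp [e]
  rw [hl, hN, AddSubmonoidClass.coe_finsetSum, Finset.sum_apply]
  refine Finset.sum_congr rfl fun x hx => ?_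
  have hx' := Finset.HasAntidiagonal.mem_antidiagonal.mp hx
  rw [if_pos (by omega)]
  have hs : ((-1) ^ (k + 1 + 1) * (-1) ^ x.1 : MvPolynomial (Fin n) R) = (-1) ^ x.2 := by
    rw [← pow_add, ← hx', show x.1 + x.2 + 1 + 1 + x.1 = x.2 + 2 * (x.1 + 1) by ring, pow_add,
      pow_mul]
    simp
  change _ = esymm (Fin n) R x.1 * ((-1) ^ x.2 * psum (Fin n) R (x.2 + 1))
  rw [← hs]
  ring

/-- The coefficients of the power series `(1 - t) / (1 - q t)`. -/
noncomputable def ratioCoeff : ℕ → Qq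
  | 0 => 1
  | j + 1 => (q - 1) * q ^ j

/-- `(1 - w u) / (1 - a w u)` has logarithmic derivative
`a w / (1 - a w u) - w / (1 - w u)`. -/
theorem derivative_ratio {A : Type*} [CommRing A] (a w : A) (c : PowerSeries A)
    (hc0 : PowerSeries.constantCoeff c = 1)
    (hc : ∀ j, PowerSeries.coeff (j + 1) c = (a - 1) * a ^ j * w ^ (j + 1)) :
    PowerSeries.derivative A c =
      c * PowerSeries.mk fun k => -((1 - a ^ (k + 1)) * w ^ (k + 1)) := by
  set d : PowerSeries A := PowerSeries.mk fun k => -((1 - a ^ (k + 1)) * w ^ (k + 1)) with hd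
  set α : PowerSeries A := PowerSeries.C a
  set ω : PowerSeries A := PowerSeries.C w
  set u : PowerSeries A := PowerSeries.X
  have h1 : c * (1 - α * ω * u) = 1 - ω * u := by
    ext n
    cases n with
    | zero => simp [mul_sub, ← mul_assoc, u, hc0]
    | succ n =>
      rw [show c * (1 - α * ω * u) = c - (c * PowerSeries.C (a * w)) * u by simp [α, ω]; ring]
      cases n with
      | zero => simp [u, ω, hc, hc0, PowerSeries.coeff_succ_mul_X, PowerSeries.coeff_one]; ring
      | succ n =>
        simp [u, ω, hc, PowerSeries.coeff_succ_mul_X, PowerSeries.coeff_one,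
          PowerSeries.coeff_mul_C, ← mul_assoc]
        ring
  -- `d` is a difference of two geometric series, `αω / (1 - αωu) - ω / (1 - ωu)`.
  have h2 : d * ((1 - ω * u) * (1 - α * ω * u)) = α * ω - ω := by
    have h3 : d = (PowerSeries.mk fun k => a ^ (k + 1) * w ^ (k + 1)) -
        PowerSeries.mk fun k => w ^ (k + 1) := by
      ext n; simp [d]; ring
    have geom : ∀ b : A, (PowerSeries.mk fun k => b ^ (k + 1)) * (1 - PowerSeries.C b * u) =
        PowerSeries.C b := by
      intro b
      ext n
      rw [show (PowerSeries.mk fun k => b ^ (k + 1)) * (1 - PowerSeries.C b * u) =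
        (PowerSeries.mk fun k => b ^ (k + 1)) -
          ((PowerSeries.mk fun k => b ^ (k + 1)) * PowerSeries.C b) * u by ring]
      cases n with
      | zero => simp [u]
      | succ n =>
        simp [u, PowerSeries.coeff_succ_mul_X, PowerSeries.coeff_mul_C]
        ring
    have g1 := geom w
    have g2 := geom (a * w)
    simp only [mul_pow, map_mul] at g2
    rw [h3]
    linear_combination (1 - ω * u) * g2 - (1 - α * ω * u) * g1
  have h4 : PowerSeries.derivative A c * (1 - α * ω * u) - c * (α * ω) = -ω := by
    have h := congrArg (PowerSeries.derivative A) h1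
    simp only [Derivation.leibniz, map_sub, smul_eq_mul, α, ω, u, ← map_mul,
      PowerSeries.derivative_C, PowerSeries.derivative_X, Derivation.map_one_eq_zero] at h
    simp only [map_mul] at h
    simp only [α, ω, u]
    linear_combination h
  -- This clears the denominators of `d`; the second factor `1 - αωu` allows `h1` to eliminate `c`.
  have hunit : IsUnit ((1 - ω * u) * (1 - α * ω * u) ^ 2) := by
    rw [PowerSeries.isUnit_iff_constantCoeff]
    simp [u]
  apply hunit.mul_right_cancel
  linear_combination (1 - ω * u) * (1 - α * ω * u) * h4 - c * (1 - α * ω * u) * h2 +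
    (α * ω * (1 - ω * u) - (α * ω - ω)) * h1

/-- If `ε` and `π` satisfy Newton's identities, and so do `τ` and
`ρ k = π k + (-1) ^ (k + 1) * (1 - a ^ (k + 1)) * w ^ (k + 1)`, then the generating function of
`τ` is that of `ε` times `(1 - w u) / (1 - a w u)`. -/
theorem eq_sum_of_newton {A : Type*} [CommRing A] [Algebra ℚ A] (a w : A) (ε τ π ρ c : ℕ → A)
    (hε0 : ε 0 = 1) (hτ0 : τ 0 = 1) (hc0 : c 0 = 1)
    (hε : ∀ k, ε (k + 1) * (k + 1) =
      ∑ x ∈ Finset.HasAntidiagonal.antidiagonal k, ε x.1 * ((-1) ^ x.2 * π x.2))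
    (hτ : ∀ k, τ (k + 1) * (k + 1) =
      ∑ x ∈ Finset.HasAntidiagonal.antidiagonal k, τ x.1 * ((-1) ^ x.2 * ρ x.2))
    (hρ : ∀ k, ρ k = π k + (-1) ^ (k + 1) * (1 - a ^ (k + 1)) * w ^ (k + 1))
    (hc : ∀ j, c (j + 1) = (a - 1) * a ^ j * w ^ (j + 1)) (r : ℕ) :
    τ r = ∑ x ∈ Finset.HasAntidiagonal.antidiagonal r, ε x.1 * c x.2 := by
  have hdc := derivative_ratio a w (PowerSeries.mk c) (by
    rw [← PowerSeries.coeff_zero_eq_constantCoeff_apply, PowerSeries.coeff_mk, hc0])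
    fun j => by rw [PowerSeries.coeff_mk, hc]
  set d : PowerSeries A := PowerSeries.mk fun k => -((1 - a ^ (k + 1)) * w ^ (k + 1)) with hd
  -- By Newton's identities, `Q` is the logarithmic derivative of the generating function of `ε`,
  -- and `Q + d` that of `τ`.
  set Q : PowerSeries A := PowerSeries.mk fun j => (-1) ^ j * π j with hQ
  have hdE : PowerSeries.derivative A (PowerSeries.mk ε) = PowerSeries.mk ε * Q := by
    ext1 k
    simp only [hQ, PowerSeries.coeff_derivative, PowerSeries.coeff_mul, PowerSeries.coeff_mk, hε]
  have hQd : Q + d = PowerSeries.mk fun j => (-1) ^ j * ρ j := by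
    ext1 j
    rw [map_add, hQ, hd, PowerSeries.coeff_mk, PowerSeries.coeff_mk, PowerSeries.coeff_mk, hρ]
    have hs : ((-1) ^ j * (-1) ^ j : A) = 1 := by
      rw [← mul_pow]; simp
    linear_combination (1 - a ^ (j + 1)) * w ^ (j + 1) * hs
  have hdT : PowerSeries.derivative A (PowerSeries.mk τ) = PowerSeries.mk τ * (Q + d) := by
    ext1 k
    simp only [hQd, PowerSeries.coeff_derivative, PowerSeries.coeff_mul, PowerSeries.coeff_mk, hτ]
  have hTE : PowerSeries.mk τ = PowerSeries.mk ε * PowerSeries.mk c := by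
    refine powerSeries_eq_of_derivative_eq_mul (P := Q + d) ?_ hdT ?_
    · rw [PowerSeries.coeff_mul]
      simp [hε0, hτ0, hc0]
    · rw [Derivation.leibniz, hdE, hdc, smul_eq_mul, smul_eq_mul]
      ring
  have h := congrArg (PowerSeries.coeff r) hTE
  simpa only [PowerSeries.coeff_mul, PowerSeries.coeff_mk] using h

/-! ### The translation on generators -/

theorem e_zero (R : Type*) [CommRing R] : e R 0 = 1 := by
  ext n : 2
  exact esymm_zero (Fin n) R

theorem translate_p (i : ℕ) : translate (p Qq i) = HahnSeries.C (p Qq i) +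
    HahnSeries.single (-((i : ℤ) + 1))
      (algebraMap Qq (SymFun Qq) ((-1) ^ (i + 1) * (1 - q ^ (i + 1)))) := by
  have h : (pEquiv Qq).symm (p Qq i) = X i := by
    rw [AlgEquiv.symm_apply_eq]
    simp [pEquiv, pHom]
  change eval₂Hom _ _ ((pEquiv Qq).symm (p Qq i)) = _
  rw [h, coe_eval₂Hom, eval₂_X]

theorem translate_algebraMap (r : Qq) :
    translate (algebraMap Qq (SymFun Qq) r) = HahnSeries.C (algebraMap Qq (SymFun Qq) r) := by
  have h : (pEquiv Qq).symm (algebraMap Qq (SymFun Qq) r) = C r := (pEquiv Qq).symm.commutes r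
  change eval₂Hom _ _ ((pEquiv Qq).symm (algebraMap Qq (SymFun Qq) r)) = _
  rw [h, coe_eval₂Hom, eval₂_C]
  rfl

/-- `e_r[X + ε(1-q)/z] = ∑_j c_j z^{-j} e_{r-j}`, where `∑_j c_j t^j = (1 - t) / (1 - q t)`. -/
theorem translate_e (r : ℕ) : translate (e Qq r) =
    ∑ x ∈ Finset.HasAntidiagonal.antidiagonal r, HahnSeries.single (-(x.2 : ℤ))
      (algebraMap Qq (SymFun Qq) (ratioCoeff x.2) * e Qq x.1) := by
  have hw : ∀ (j : ℕ) (F : SymFun Qq),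
      HahnSeries.C F * (HahnSeries.single (-1) 1 : LaurentSeries (SymFun Qq)) ^ j =
        HahnSeries.single (-(j : ℤ)) F := fun j F => by
    rw [HahnSeries.single_pow, HahnSeries.C_apply, HahnSeries.single_mul_single]
    simp only [nsmul_eq_mul, mul_neg, mul_one, zero_add, one_pow]
  -- Here `a = q` and `w = z⁻¹`. Newton's identities survive both `HahnSeries.C` and `translate`
  -- because these are ring homomorphisms.
  rw [eq_sum_of_newton (HahnSeries.C (algebraMap Qq (SymFun Qq) q))
    (HahnSeries.single (-1) 1 : LaurentSeries (SymFun Qq)) (fun j => HahnSeries.C (e Qq j))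
    (fun j => translate (e Qq j)) (fun j => HahnSeries.C (p Qq j)) (fun j => translate (p Qq j))
    (fun j => HahnSeries.single (-(j : ℤ)) (algebraMap Qq (SymFun Qq) (ratioCoeff j)))
    ?_ ?_ ?_ ?_ ?_ ?_ ?_ r]
  · refine Finset.sum_congr rfl fun x _ => ?_
    rw [HahnSeries.C_apply, HahnSeries.single_mul_single, zero_add, mul_comm]
  · rw [e_zero, map_one]
  · rw [e_zero, map_one]
  · rw [ratioCoeff, map_one, Nat.cast_zero, neg_zero]
    rfl
  · intro k
    have h := congrArg (HahnSeries.C (Γ := ℤ)) (e_succ_mul_eq_sum Qq k)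
    simpa only [map_mul, map_add, map_sum, map_pow, map_neg, map_one, map_natCast] using h
  · intro k
    have h := congrArg translate (e_succ_mul_eq_sum Qq k)
    simpa only [map_mul, map_add, map_sum, map_pow, map_neg, map_one, map_natCast] using h
  · intro k
    rw [translate_p, show -((k : ℤ) + 1) = -((k + 1 : ℕ) : ℤ) by simp, ← hw]
    simp only [map_mul, map_sub, map_pow, map_neg, map_one]
  · intro j
    rw [← hw, ratioCoeff]
    simp only [map_mul, map_sub, map_pow, map_one]

/-! ### The cone of `e`-positive functions -/

/-- The substitution `q ↦ q - 1` in a polynomial with natural coefficients. -/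
noncomputable def unshift : Polynomial ℕ →+* Qq :=
  (Polynomial.compRingHom (q - 1)).comp (Polynomial.mapRingHom (Nat.castRingHom ℚ))

theorem unshift_comp (P : Polynomial ℕ) :
    (unshift P).comp (1 + q) = P.map (Nat.castRingHom ℚ) := by
  simp [unshift, Polynomial.comp_assoc]

/-- The source of positivity: `(q - 1) q^j` is a polynomial in `q - 1` with natural coefficients. -/
theorem exists_unshift_eq_ratioCoeff (j : ℕ) : ∃ P, unshift P = ratioCoeff j := by
  cases j with
  | zero => exact ⟨1, map_one _⟩
  | succ j =>
    refine ⟨Polynomial.X * (Polynomial.X + 1) ^ j, ?_⟩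
    simp [unshift, ratioCoeff]

/-- The symmetric functions, homogeneous of degree `d`, that become `e`-positive after the
substitution `q ↦ 1 + q`. -/
noncomputable def ePos (d : ℤ) : AddSubmonoid (SymFun Qq) :=
  AddSubmonoid.closure {F | ∃ (P : Polynomial ℕ) (s : Multiset ℕ),
    (∀ i ∈ s, 0 < i) ∧ (s.sum : ℤ) = d ∧
      F = algebraMap Qq (SymFun Qq) (unshift P) * (s.map (e Qq)).prod}

theorem algebraMap_mul_prod_mem_ePos (P : Polynomial ℕ) (s : Multiset ℕ) (hs : ∀ i ∈ s, 0 < i) :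
    algebraMap Qq (SymFun Qq) (unshift P) * (s.map (e Qq)).prod ∈ ePos s.sum :=
  AddSubmonoid.subset_closure ⟨P, s, hs, rfl, rfl⟩

/-- Two generators multiply to a generator: the coefficients multiply and the multisets of indices
are added. -/
theorem mul_mem_ePos {F G : SymFun Qq} {c d : ℤ} (hF : F ∈ ePos c) (hG : G ∈ ePos d) :
    F * G ∈ ePos (c + d) := by
  induction hF using AddSubmonoid.closure_induction with
  | zero => rw [zero_mul]; exact zero_mem _
  | add x y _ _ hx hy => rw [add_mul]; exact add_mem hx hy
  | mem x hx =>
    obtain ⟨P, s, hs, rfl, rfl⟩ := hx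
    induction hG using AddSubmonoid.closure_induction with
    | zero => rw [mul_zero]; exact zero_mem _
    | add x y _ _ hx hy => rw [mul_add]; exact add_mem hx hy
    | mem y hy =>
      obtain ⟨P', t, ht, rfl, rfl⟩ := hy
      have h := algebraMap_mul_prod_mem_ePos (P * P') (s + t) fun i hi =>
        (Multiset.mem_add.mp hi).elim (hs i) (ht i)
      rw [Multiset.sum_add, Nat.cast_add, map_mul, map_mul, Multiset.map_add,
        Multiset.prod_add, mul_mul_mul_comm] at h
      exact h

theorem algebraMap_mem_ePos (P : Polynomial ℕ) :
    algebraMap Qq (SymFun Qq) (unshift P) ∈ ePos 0 := by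
  simpa using algebraMap_mul_prod_mem_ePos P 0 (by simp)

theorem one_mem_ePos : (1 : SymFun Qq) ∈ ePos 0 := by
  simpa using algebraMap_mem_ePos 1

theorem e_mem_ePos (r : ℕ) : e Qq r ∈ ePos r := by
  -- Generators allow only positive indices, so `e_0 = 1` must come from the empty product.
  rcases Nat.eq_zero_or_pos r with rfl | hr
  · rw [e_zero]
    exact one_mem_ePos
  · simpa using algebraMap_mul_prod_mem_ePos 1 {r} (by simpa using hr)

/-- The Laurent series whose coefficients become `e`-positive after the substitution `q ↦ 1 + q`,
and which are homogeneous of degree `d` when `z` is given degree `-1`. -/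
noncomputable def laurentEPos (d : ℤ) : AddSubmonoid (LaurentSeries (SymFun Qq)) where
  carrier := {f | ∀ i, f.coeff i ∈ ePos (d + i)}
  zero_mem' := fun _ => zero_mem _
  add_mem' := fun hf hg i => add_mem (hf i) (hg i)

theorem mul_mem_laurentEPos {f g : LaurentSeries (SymFun Qq)} {c d : ℤ} (hf : f ∈ laurentEPos c)
    (hg : g ∈ laurentEPos d) : f * g ∈ laurentEPos (c + d) := by
  intro i
  rw [HahnSeries.coeff_mul]
  refine sum_mem fun x hx => ?_
  obtain ⟨-, -, hx⟩ := Finset.mem_antidiagonal.mp hx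
  rw [← hx, add_add_add_comm]
  exact mul_mem_ePos (hf _) (hg _)

theorem single_mem_laurentEPos {F : SymFun Qq} {d i : ℤ} (hF : F ∈ ePos (d + i)) :
    HahnSeries.single i F ∈ laurentEPos d := by
  intro j
  by_cases h : j = i
  · rw [h, HahnSeries.coeff_single_same]
    exact hF
  · rw [HahnSeries.coeff_single_of_ne h]
    exact zero_mem _

/-- In each term `c_j z^(-j) e_(r-j)` the factor `z^(-j)` contributes the missing degree `j`. -/
theorem translate_e_mem (r : ℕ) : translate (e Qq r) ∈ laurentEPos r := by
  rw [translate_e]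
  refine sum_mem fun x hx => single_mem_laurentEPos ?_
  rw [Finset.HasAntidiagonal.mem_antidiagonal] at hx
  obtain ⟨P, hP⟩ := exists_unshift_eq_ratioCoeff x.2
  rw [← hP]
  have h := mul_mem_ePos (algebraMap_mem_ePos P) (e_mem_ePos x.1)
  rwa [show (r : ℤ) + -(x.2 : ℤ) = 0 + x.1 by omega]

/-- By additivity and multiplicativity it suffices to treat scalars, which are fixed, and single
`e_r`. -/
theorem translate_mem {F : SymFun Qq} {d : ℤ} (hF : F ∈ ePos d) :
    translate F ∈ laurentEPos d := by
  induction hF using AddSubmonoid.closure_induction with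
  | zero => rw [map_zero]; exact zero_mem _
  | add x y _ _ hx hy => rw [map_add]; exact add_mem hx hy
  | mem x hx =>
    obtain ⟨P, s, -, rfl, rfl⟩ := hx
    rw [map_mul, translate_algebraMap, ← zero_add (s.sum : ℤ)]
    refine mul_mem_laurentEPos (single_mem_laurentEPos (algebraMap_mem_ePos P)) ?_
    induction s using Multiset.induction with
    | empty =>
      rw [Multiset.map_zero, Multiset.prod_zero, map_one]
      exact single_mem_laurentEPos one_mem_ePos
    | cons r s ih =>
      rw [Multiset.map_cons, Multiset.prod_cons, map_mul, Multiset.sum_cons, Nat.cast_add]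
      exact mul_mem_laurentEPos (translate_e_mem r) ih

theorem eSeries_mem : eSeries ∈ laurentEPos 0 := by
  intro i
  rw [zero_add, eSeries]
  rcases lt_or_ge i 0 with hi | hi
  -- Negative exponents lie outside the image of `ℕ`, so the coefficient vanishes.
  · rw [HahnSeries.ofPowerSeries_apply, HahnSeries.embDomain_of_notMem_range]
    · exact zero_mem _
    · rintro ⟨n, rfl⟩
      simp at hi
      omega
  · lift i to ℕ using hi
    have h := HahnSeries.ofPowerSeries_apply_coeff (Γ := ℤ) (PowerSeries.mk (e Qq)) i
    rw [PowerSeries.coeff_mk] at h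
    rw [show ((i : ℕ) : ℤ) = (Nat.cast i : ℤ) from rfl]
    rw [h]
    exact e_mem_ePos i

/-- `B_a` preserves `e`-positivity after the substitution `q ↦ 1 + q`, and raises the degree
by `a`. -/
theorem B_mem_ePos {F : SymFun Qq} {d : ℤ} (hF : F ∈ ePos d) (a : ℤ) : B a F ∈ ePos (d + a) := by
  have h := mul_mem_laurentEPos (translate_mem hF) eSeries_mem a
  rwa [add_zero] at h

theorem Bone_mem_ePos (l : List ℕ) : Bone l ∈ ePos l.sum := by
  induction l with
  | nil => exact one_mem_ePos
  | cons a l ih =>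
    rw [List.sum_cons, Nat.cast_add, add_comm]
    exact B_mem_ePos ih a

/-! ### Substituting `1 + q` and collecting partitions -/

/-- Coefficientwise application of a ring homomorphism, as a ring homomorphism. -/
noncomputable def mapCoeffHom {R S : Type*} [CommRing R] [CommRing S] (φ : R →+* S) : SymFun R →+* SymFun S where
  toFun := mapCoeff φ
  map_one' := by ext n : 2; exact map_one (MvPolynomial.map φ)
  map_zero' := by ext n : 2; exact map_zero (MvPolynomial.map φ)
  map_mul' f g := by ext n : 2; exact map_mul (MvPolynomial.map φ) _ _
  map_add' f g := by ext n : 2; exact map_add (MvPolynomial.map φ) _ _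

theorem mapCoeffHom_e {R S : Type*} [CommRing R] [CommRing S] (φ : R →+* S) (k : ℕ) :
    mapCoeffHom φ (e R k) = e S k := by
  ext n : 2
  exact map_esymm (Fin n) R k φ

theorem mapCoeffHom_algebraMap {R S : Type*} [CommRing R] [CommRing S] (φ : R →+* S) (r : R) :
    mapCoeffHom φ (algebraMap R (SymFun R) r) = algebraMap S (SymFun S) (φ r) := by
  ext n : 2
  exact map_C φ r

/-- On a generator, `q ↦ 1 + q` undoes `unshift` and fixes the `e_k`, leaving `P • e_μ` for the
partition `μ` formed by its indices. Sums of generators add the families `P`, so linear independence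
of the `e_μ` plays no role. -/
theorem exists_shift_eq_sum {n : ℕ} {F : SymFun Qq} (hF : F ∈ ePos n) :
    ∃ P : n.Partition → Polynomial ℕ,
      shift F = ∑ μ : n.Partition, (P μ).map (Nat.castRingHom ℚ) • ePart μ := by
  change ∃ P : n.Partition → Polynomial ℕ, mapCoeffHom (Polynomial.compRingHom (1 + q)) F = _
  induction hF using AddSubmonoid.closure_induction with
  | zero => exact ⟨0, by simp⟩
  | add x y _ _ hx hy =>
    obtain ⟨P, hP⟩ := hx
    obtain ⟨P', hP'⟩ := hy
    refine ⟨P + P', ?_⟩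
    rw [map_add, hP, hP', ← Finset.sum_add_distrib]
    simp [add_smul]
  | mem x hx =>
    obtain ⟨P, s, hs, hd, rfl⟩ := hx
    set μ : n.Partition := ⟨s, fun {i} hi => hs i hi, by exact_mod_cast hd⟩ with hμ
    classical
    refine ⟨Pi.single μ P, ?_⟩
    rw [Finset.sum_eq_single μ (fun ν _ hν => by simp [Pi.single_eq_of_ne hν]) (by simp),
      Pi.single_eq_same, map_mul, mapCoeffHom_algebraMap, Polynomial.coe_compRingHom_apply,
      unshift_comp, map_multiset_prod, Multiset.map_map, Algebra.smul_def, ePart]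
    congr 3
    exact funext fun k => mapCoeffHom_e _ k

end SymmFn

theorem theorem2p1 (n : ℕ) (p : Composition n) :
    ∃ P : n.Partition → Polynomial ℕ,
      SymmFn.shift (SymmFn.Bone p.blocks) =
        ∑ μ : n.Partition, (P μ).map (Nat.castRingHom ℚ) • SymmFn.ePart μ := by
  refine SymmFn.exists_shift_eq_sum ?_
  have h := SymmFn.Bone_mem_ePos p.blocks
  rwa [p.blocks_sum] at h
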